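/- Let $d\ge 1$ and let $P,Q$ be probability distributions on $\mathbb{R}^d$ with the same one-dimensional marginals, i.e. for every $i$ the coordinate $x_i$ of $x=(x_1,\dots,x_d)$ has the same law under $P$ as under $Q$. Assume that under $P$, for all $i,j\in\{1,\dots,d\}$, the pair $(x_i,x_j)$ is a (possibly degenerate) two-dimensional Gaussian random vector, and that $\mathrm{Var}_P(x_i)>0$ for every $i$. (Under $Q$ the pairs are not required to be Gaussian.) Let $\tilde x_i=(x_i-\mathbb{E}_P[x_i])\,\mathrm{Var}_P(x_i)^{-1/2}$, let $\tilde\Sigma_P=\mathbb{E}_P[\tilde x\tilde x^\top]$ be the correlation matrix, and let $\lambda_{\min}(\tilde\Sigma_P)\ge 0$ be its smallest eigenvalue. Let $$\mathcal{F}=\Big\{x\mapsto \sum_{i=1}^d f_i(x_i)\;:\; f_i:\mathbb{R}\to\mathbb{R}\text{ measurable with respect to the completed law of }x_i,\ \mathbb{E}_P[f_i(x_i)^2]<\infty \text{ for all } i\Big\},$$ and define the $\mathcal{F}$-restricted error ratio $$\tau(P,Q,\mathcal{F})=\sup_{f,g\in\mathcal{F}}\frac{\mathbb{E}_Q[(f(x)-g(x))^2]}{\mathbb{E}_P[(f(x)-g(x))^2]}\in[0,\infty],$$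 with the conventions $0/0=0$ and $c/0=\infty$ for $c>0$. Then $$\tau(P,Q,\mathcal{F})\le \frac{d}{\lambda_{\min}(\tilde\Sigma_P)},$$ where the right-hand side is $+\infty$ if $\lambda_{\min}(\tilde\Sigma_P)=0$. -/

import Mathlib

open MeasureTheory ProbabilityTheory

noncomputable section

/-- The second moment `E_μ[h(x)²] ∈ [0, ∞]` of a real function `h`. -/
def secondMoment {X : Type*} [MeasurableSpace X] (μ : Measure X) (h : X → ℝ) : ENNReal :=
  ∫⁻ x, ENNReal.ofReal (h x ^ 2) ∂μ

/-- The `F`-restricted error ratio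
`τ(P, Q, F) = sup_{f, g ∈ F} E_Q[(f - g)²] / E_P[(f - g)²] ∈ [0, ∞]`.
Division in `ENNReal` has `0 / 0 = 0` and `c / 0 = ∞` for `c ≠ 0`. -/
def restrictedErrorRatio {X : Type*} [MeasurableSpace X] (P Q : Measure X)
    (F : Set (X → ℝ)) : ENNReal :=
  ⨆ f ∈ F, ⨆ g ∈ F,
    secondMoment Q (fun x => f x - g x) / secondMoment P (fun x => f x - g x)

/-- The class of additive models `x ↦ ∑ i, f_i (x_i)`, where the `f_i : ℝ → ℝ` are
(a.e.) measurable functions with `E_P[f_i(x_i)²] < ∞`. -/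
def additiveClass {d : ℕ} (P : Measure (Fin d → ℝ)) : Set ((Fin d → ℝ) → ℝ) :=
  {F | ∃ f : Fin d → ℝ → ℝ,
    (∀ i, AEMeasurable (f i) (P.map (fun x => x i))) ∧
    (∀ i, secondMoment P (fun x => f i (x i)) < ⊤) ∧
    F = fun x => ∑ i, f i (x i)}

/-- The `i`-th standardized feature `(x_i - E_P[x_i]) Var_P(x_i)^{-1/2}`. -/
def standardized {d : ℕ} (P : Measure (Fin d → ℝ)) (i : Fin d) (x : Fin d → ℝ) : ℝ :=
  (x i - ∫ y, y i ∂P) / Real.sqrt (variance (fun y => y i) P)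

/-- The second-moment matrix of the standardized features under `P`. -/
def correlationMatrix {d : ℕ} (P : Measure (Fin d → ℝ)) : Matrix (Fin d) (Fin d) ℝ :=
  Matrix.of fun i j => ∫ x, standardized P i x * standardized P j x ∂P

theorem correlationMatrix_isHermitian {d : ℕ} (P : Measure (Fin d → ℝ)) :
    (correlationMatrix P).IsHermitian := by
  ext i j
  simp [correlationMatrix, mul_comm]

/-- The smallest eigenvalue of a real symmetric matrix (of positive size). -/
def lambdaMin {d : ℕ} {M : Matrix (Fin d) (Fin d) ℝ} (hM : M.IsHermitian) : ℝ :=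
  ⨅ i, hM.eigenvalues i

end

open scoped Matrix InnerProductSpace

/-! Write h = f - g = ∑ h_i and split off the means. The squared total mean is the same under P and
Q. By Cauchy–Schwarz the centred part has Q-second moment at most d ∑ Var(h_i), and these variances
depend only on the shared marginals. It remains to show that under P the centred part has second
moment at least λ ∑ Var(h_i), where λ is the least eigenvalue of the correlation matrix R.

For standardized Gaussian pairs, the centred exponentials exp(t X_i - t²/2) - 1 have inner products
exp(R_ij s t) - 1 = ∑_{m≥1} R_ij^m (st)^m / m!. Hence the Gram matrix of combinations of them is a
sum over m of entrywise powers of R, weighted by rank-one matrices. By the Schur product theorem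
each entrywise power still dominates λ I (`posSemidef_hadamardPow_sub`), which gives the bound on
spans (`norm_sum_sq_ge_of_mem_span`). Exponentials are total in Gaussian L²
(`topologicalClosure_span_wickExp`), so it extends to all square-integrable components. Only inner
products of pairs enter, so pairwise Gaussianity suffices. -/

/-! ### Entrywise powers of a correlation matrix -/

/-- The unit diagonal makes the Hadamard product of c I with a power of R equal to c I, so the
difference factors as (R - c I) ⊙ R^{∘m} and Schur's theorem applies. Power zero is excluded: the
all-ones matrix fails the bound when c > 0 and the size exceeds one. -/
theorem posSemidef_hadamardPow_sub {n : Type*} [Fintype n] [DecidableEq n]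
    {R : Matrix n n ℝ} {c : ℝ} (hR : R.PosSemidef) (hdiag : ∀ i, R i i = 1)
    (hc : (R - c • (1 : Matrix n n ℝ)).PosSemidef) (m : ℕ) :
    (Matrix.of (fun i j => R i j ^ (m + 1)) - c • (1 : Matrix n n ℝ)).PosSemidef := by
  have hpow : ∀ m : ℕ, (Matrix.of (fun i j => R i j ^ (m + 1))).PosSemidef := by
    intro m
    induction m with
    | zero =>
      have h : (Matrix.of fun i j => R i j ^ (0 + 1)) = R := by ext i j; simp
      rwa [h]
    | succ m ih =>
      have h : (Matrix.of fun i j => R i j ^ (m + 1 + 1)) =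
          (Matrix.of fun i j => R i j ^ (m + 1)) ⊙ R := by
        ext i j
        simp [pow_succ]
      rw [h]
      exact ih.hadamard hR
  cases m with
  | zero =>
    have h : (Matrix.of fun i j => R i j ^ (0 + 1)) = R := by ext i j; simp
    rwa [h]
  | succ m =>
    have h : (Matrix.of fun i j => R i j ^ (m + 1 + 1)) - c • (1 : Matrix n n ℝ) =
        (R - c • (1 : Matrix n n ℝ)) ⊙ (Matrix.of fun i j => R i j ^ (m + 1)) := by
      ext i j
      by_cases hij : i = j
      · subst hij
        simp [hdiag]
      · simp [hij, pow_succ' (R i j) (m + 1)]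
    rw [h]
    exact hc.hadamard (hpow m)

theorem sum_mul_sum_nonneg_of_posSemidef_sub {n : Type*} [Fintype n] [DecidableEq n]
    {M : Matrix n n ℝ} {c : ℝ} (h : (M - c • (1 : Matrix n n ℝ)).PosSemidef) (b : n → ℝ) :
    c * ∑ i, b i * b i ≤ ∑ i, ∑ j, M i j * (b i * b j) := by
  have h0 := h.dotProduct_mulVec_nonneg b
  simp only [star_trivial, Matrix.sub_mulVec, Matrix.smul_mulVec, Matrix.one_mulVec,
    dotProduct_sub, dotProduct_smul, smul_eq_mul, sub_nonneg] at h0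
  refine h0.trans (le_of_eq ?_)
  simp only [dotProduct, Matrix.mulVec, Finset.mul_sum]
  exact Finset.sum_congr rfl fun i _ => Finset.sum_congr rfl fun j _ => by ring

theorem hasSum_exp_sub_one (x : ℝ) :
    HasSum (fun n : ℕ => x ^ (n + 1) / ((n + 1).factorial : ℝ)) (Real.exp x - 1) := by
  have h : HasSum (fun n : ℕ => x ^ n / (n.factorial : ℝ)) (Real.exp x) := by
    rw [Real.exp_eq_exp_ℝ]
    exact NormedSpace.expSeries_div_hasSum_exp x
  simpa using (hasSum_nat_add_iff' 1).2 h

/-! ### Lower bound for sums in a Hilbert space -/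

section Hilbert

variable {H : Type*} [NormedAddCommGroup H] [InnerProductSpace ℝ H]

theorem norm_sum_sq_ge_of_mem_span {n : Type*} [Fintype n] [DecidableEq n]
    {R : Matrix n n ℝ} {c : ℝ} (hR : R.PosSemidef) (hdiag : ∀ i, R i i = 1)
    (hc : (R - c • (1 : Matrix n n ℝ)).PosSemidef) (e : n → ℝ → H)
    (he : ∀ i j s t, ⟪e i s, e j t⟫_ℝ = Real.exp (R i j * (s * t)) - 1) (w : n → H)
    (hw : ∀ i, w i ∈ Submodule.span ℝ (Set.range (e i))) :
    c * ∑ i, ‖w i‖ ^ 2 ≤ ‖∑ i, w i‖ ^ 2 := by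
  simp only [Finsupp.mem_span_range_iff_exists_finsupp] at hw
  choose a ha using hw
  -- Moments of the coefficients: the degree m + 1 term of ⟪w i, w j⟫ separates into b m i * b m j.
  set b : ℕ → n → ℝ := fun m i => ∑ s ∈ (a i).support, a i s * s ^ (m + 1) with hb
  have hsum : ∀ i j, HasSum
      (fun m : ℕ => R i j ^ (m + 1) / ((m + 1).factorial : ℝ) * (b m i * b m j))
      ⟪w i, w j⟫_ℝ := by
    intro i j
    have h1 : ⟪w i, w j⟫_ℝ = ∑ s ∈ (a i).support, ∑ t ∈ (a j).support,
        a i s * a j t * (Real.exp (R i j * (s * t)) - 1) := by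
      rw [← ha i, ← ha j, Finsupp.sum, Finsupp.sum, sum_inner]
      refine Finset.sum_congr rfl fun s _ => ?_
      rw [inner_sum]
      refine Finset.sum_congr rfl fun t _ => ?_
      rw [inner_smul_left, inner_smul_right, he]
      simp [mul_assoc]
    rw [h1]
    have h2 := hasSum_sum fun s (_ : s ∈ (a i).support) =>
      hasSum_sum fun t (_ : t ∈ (a j).support) =>
        (hasSum_exp_sub_one (R i j * (s * t))).mul_left (a i s * a j t)
    refine h2.congr_fun fun m => ?_
    simp only [hb]
    rw [Finset.sum_mul_sum]
    simp only [Finset.mul_sum]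
    exact Finset.sum_congr rfl fun s _ => Finset.sum_congr rfl fun t _ => by ring
  have hL : HasSum (fun m : ℕ => c * ∑ i, R i i ^ (m + 1) / ((m + 1).factorial : ℝ) *
      (b m i * b m i)) (c * ∑ i, ‖w i‖ ^ 2) := by
    refine (hasSum_sum fun i _ => ?_).mul_left c
    rw [← real_inner_self_eq_norm_sq]
    exact hsum i i
  have hRs : HasSum (fun m : ℕ => ∑ i, ∑ j, R i j ^ (m + 1) / ((m + 1).factorial : ℝ) *
      (b m i * b m j)) (‖∑ i, w i‖ ^ 2) := by
    rw [← real_inner_self_eq_norm_sq, sum_inner]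
    simp only [inner_sum]
    exact hasSum_sum fun i _ => hasSum_sum fun j _ => hsum i j
  refine hasSum_le (fun m => ?_) hL hRs
  have hq := sum_mul_sum_nonneg_of_posSemidef_sub
    (posSemidef_hadamardPow_sub hR hdiag hc m) (b m)
  have hf : (0 : ℝ) ≤ ((m + 1).factorial : ℝ)⁻¹ := by positivity
  have := mul_le_mul_of_nonneg_left hq hf
  simp only [Matrix.of_apply, Finset.mul_sum] at this
  simp only [hdiag, one_pow, Finset.mul_sum]
  refine (le_of_eq ?_).trans (this.trans (le_of_eq ?_))
  · exact Finset.sum_congr rfl fun i _ => by ring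
  · exact Finset.sum_congr rfl fun i _ => Finset.sum_congr rfl fun j _ => by ring

/-- The inequality is a closed condition on w, and the closure of a product of spans is the product
of their closures. -/
theorem norm_sum_sq_ge_of_mem_closure_span {n : Type*} [Fintype n] [DecidableEq n]
    {R : Matrix n n ℝ} {c : ℝ} (hR : R.PosSemidef) (hdiag : ∀ i, R i i = 1)
    (hc : (R - c • (1 : Matrix n n ℝ)).PosSemidef) (e : n → ℝ → H)
    (he : ∀ i j s t, ⟪e i s, e j t⟫_ℝ = Real.exp (R i j * (s * t)) - 1) (w : n → H)
    (hw : ∀ i, w i ∈ (Submodule.span ℝ (Set.range (e i))).topologicalClosure) :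
    c * ∑ i, ‖w i‖ ^ 2 ≤ ‖∑ i, w i‖ ^ 2 := by
  have hcl : IsClosed {w : n → H | c * ∑ i, ‖w i‖ ^ 2 ≤ ‖∑ i, w i‖ ^ 2} :=
    isClosed_le (by fun_prop) (by fun_prop)
  have hmem : w ∈ closure (Set.univ.pi fun i => (Submodule.span ℝ (Set.range (e i)) : Set H)) := by
    rw [closure_pi_set]
    intro i _
    exact hw i
  refine closure_minimal (fun v hv => ?_) hcl hmem
  exact norm_sum_sq_ge_of_mem_span hR hdiag hc e he v fun i => hv i (Set.mem_univ i)

end Hilbert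

/-! ### The smallest eigenvalue -/

theorem posSemidef_sub_lambdaMin {d : ℕ} {M : Matrix (Fin d) (Fin d) ℝ}
    (hM : M.IsHermitian) : (M - lambdaMin hM • (1 : Matrix (Fin d) (Fin d) ℝ)).PosSemidef := by
  have hH : (M - lambdaMin hM • (1 : Matrix (Fin d) (Fin d) ℝ)).IsHermitian := by
    refine hM.sub ?_
    ext i j
    simp [Matrix.one_apply, eq_comm]
  rw [hH.posSemidef_iff_eigenvalues_nonneg]
  intro i
  have hi := hH.eigenvalues_mem_spectrum_real i
  rw [Pi.zero_apply]
  generalize hH.eigenvalues i = x at hi ⊢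
  rw [← Algebra.algebraMap_eq_smul_one, ← spectrum.sub_singleton_eq,
    hM.spectrum_real_eq_range_eigenvalues] at hi
  obtain ⟨_, ⟨j, rfl⟩, _, rfl, rfl⟩ := Set.mem_sub.1 hi
  have := ciInf_le (Set.finite_range hM.eigenvalues).bddBelow j
  exact sub_nonneg.2 this

/-! ### Totality of exponentials in Gaussian L² -/

/-- The measures with densities f⁺ and f⁻ have the same everywhere finite moment generating
function. Analytic continuation makes their complex transforms agree, so the measures coincide and
f⁺ = f⁻ almost everywhere. -/
theorem ae_eq_zero_of_forall_integral_mul_exp_eq_zero {μ : Measure ℝ} [IsFiniteMeasure μ]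
    (hexp : ∀ t : ℝ, MemLp (fun x => Real.exp (t * x)) 2 μ) {f : ℝ → ℝ} (hf : MemLp f 2 μ)
    (h : ∀ t : ℝ, ∫ x, f x * Real.exp (t * x) ∂μ = 0) : f =ᵐ[μ] 0 := by
  have hfi : Integrable f μ := hf.integrable (by norm_num)
  have key : ∀ {g : ℝ → ℝ}, MemLp g 2 μ → ∀ t : ℝ,
      Integrable (fun x => Real.exp (t * x)) (μ.withDensity fun x => ENNReal.ofReal (g x)) ∧
      mgf id (μ.withDensity fun x => ENNReal.ofReal (g x)) t =
        ∫ x, max (g x) 0 * Real.exp (t * x) ∂μ := by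
    intro g hg t
    have hm : AEMeasurable (fun x => (g x).toNNReal) μ := hg.1.aemeasurable.real_toNNReal
    constructor
    · change Integrable _ (μ.withDensity fun x => ((g x).toNNReal : ENNReal))
      rw [integrable_withDensity_iff_integrable_smul₀ hm]
      have := MemLp.integrable_mul (hexp t) hg.pos_part
      refine this.congr (Filter.Eventually.of_forall fun x => ?_)
      simp [NNReal.smul_def, mul_comm]
    · change ∫ x, _ ∂(μ.withDensity fun x => ((g x).toNNReal : ENNReal)) = _
      rw [integral_withDensity_eq_integral_smul₀ hm]
      simp [NNReal.smul_def]
  have hpos := key hf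
  have hneg := key hf.neg
  set μ₁ := μ.withDensity fun x => ENNReal.ofReal (f x)
  set μ₂ := μ.withDensity fun x => ENNReal.ofReal ((-f) x)
  have : IsFiniteMeasure μ₁ := isFiniteMeasure_withDensity_ofReal hfi.2
  have : IsFiniteMeasure μ₂ := isFiniteMeasure_withDensity_ofReal hfi.neg.2
  have hmgf : mgf id μ₁ = mgf id μ₂ := by
    ext t
    have hsub := integral_sub (MemLp.integrable_mul hf.pos_part (hexp t))
      (MemLp.integrable_mul hf.neg.pos_part (hexp t))
    simp only [Pi.mul_apply] at hsub
    rw [(hpos t).2, (hneg t).2, ← sub_eq_zero, ← hsub]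
    refine Eq.trans ?_ (h t)
    refine integral_congr_ae (Filter.Eventually.of_forall fun x => ?_)
    simp only [Pi.neg_apply]
    rcases le_total (f x) 0 with h0 | h0
    · rw [max_eq_right h0, max_eq_left (by linarith)]; ring
    · rw [max_eq_left h0, max_eq_right (by linarith)]; ring
  have hset : integrableExpSet id μ₁ = Set.univ := by
    ext t
    simpa [integrableExpSet] using (hpos t).1
  -- The total mass is the moment generating function at 0.
  have hzero : μ₁ = 0 ↔ μ₂ = 0 := by
    have h0 := congrFun hmgf 0
    simp only [mgf_zero'] at h0
    rw [← Measure.measure_univ_eq_zero, ← Measure.measure_univ_eq_zero,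
      ← measureReal_eq_zero_iff, ← measureReal_eq_zero_iff, h0]
  have hcomplex : complexMGF id μ₁ = complexMGF id μ₂ := by
    ext z
    exact eqOn_complexMGF_of_mgf' hmgf hzero (by simp [hset])
  have heq : μ₁ = μ₂ := Measure.ext_of_complexMGF_id_eq hcomplex
  have hae := (withDensity_eq_iff hf.1.aemeasurable.ennreal_ofReal
    hf.neg.1.aemeasurable.ennreal_ofReal hfi.lintegral_lt_top.ne).1 heq
  filter_upwards [hae] with x hx
  simp only [Pi.neg_apply] at hx
  rcases le_total (f x) 0 with h0 | h0
  · rw [ENNReal.ofReal_of_nonpos h0, eq_comm, ENNReal.ofReal_eq_zero] at hx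
    exact le_antisymm h0 (neg_nonpos.1 hx)
  · rw [ENNReal.ofReal_of_nonpos (p := -f x) (by linarith), ENNReal.ofReal_eq_zero] at hx
    exact le_antisymm hx h0

theorem inner_toLp_toLp {Ω : Type*} [MeasurableSpace Ω] {μ : Measure Ω} {f g : Ω → ℝ}
    (hf : MemLp f 2 μ) (hg : MemLp g 2 μ) :
    ⟪hf.toLp f, hg.toLp g⟫_ℝ = ∫ x, f x * g x ∂μ := by
  rw [L2.inner_def]
  refine integral_congr_ae ?_
  filter_upwards [hf.coeFn_toLp, hg.coeFn_toLp] with x hx hy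
  rw [hx, hy]
  simp [mul_comm]

/-- The exponential `exp (t x - t² / 2)`, which has mean one under the standard Gaussian law. -/
noncomputable def wickExp (t x : ℝ) : ℝ := Real.exp (t * x - t ^ 2 / 2)

theorem wickExp_eq (t x : ℝ) : wickExp t x = Real.exp (-(t ^ 2 / 2)) * Real.exp (t * x) := by
  rw [wickExp, ← Real.exp_add]; ring_nf

theorem measurable_wickExp (t : ℝ) : Measurable (wickExp t) := by
  unfold wickExp; fun_prop

theorem memLp_exp_mul_gaussianReal (t m : ℝ) (v : NNReal) :
    MemLp (fun x => Real.exp (t * x)) 2 (gaussianReal m v) := by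
  rw [memLp_two_iff_integrable_sq (by fun_prop)]
  refine (integrable_exp_mul_gaussianReal (μ := m) (v := v) (2 * t)).congr
    (Filter.Eventually.of_forall fun x => ?_)
  simp only [← Real.exp_nat_mul]
  push_cast; ring_nf

theorem memLp_wickExp (t : ℝ) : MemLp (wickExp t) 2 (gaussianReal 0 1) := by
  have := (memLp_exp_mul_gaussianReal t 0 1).const_mul (Real.exp (-(t ^ 2 / 2)))
  refine this.ae_eq (Filter.Eventually.of_forall fun x => (wickExp_eq t x).symm)

theorem integral_wickExp (t : ℝ) : ∫ x, wickExp t x ∂(gaussianReal 0 1) = 1 := by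
  simp only [wickExp_eq]
  rw [integral_const_mul]
  have h := congrFun (mgf_fun_id_gaussianReal (μ := 0) (v := 1)) t
  rw [mgf] at h
  rw [h, ← Real.exp_add]
  simp

theorem topologicalClosure_span_wickExp :
    (Submodule.span ℝ (Set.range fun t => (memLp_wickExp t).toLp)).topologicalClosure = ⊤ := by
  rw [Submodule.topologicalClosure_eq_top_iff, Submodule.eq_bot_iff]
  intro f hf
  rw [Submodule.mem_orthogonal] at hf
  rw [Lp.eq_zero_iff_ae_eq_zero]
  refine ae_eq_zero_of_forall_integral_mul_exp_eq_zero
    (fun t => memLp_exp_mul_gaussianReal t 0 1) (Lp.memLp f) fun t => ?_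
  have h := hf _ (Submodule.subset_span ⟨t, rfl⟩)
  rw [← Lp.toLp_coeFn f (Lp.memLp f), inner_toLp_toLp] at h
  simp only [wickExp_eq, mul_assoc] at h
  rw [integral_const_mul, mul_eq_zero] at h
  rcases h with h | h
  · exact absurd h (Real.exp_ne_zero _)
  · refine Eq.trans ?_ h
    exact integral_congr_ae (Filter.Eventually.of_forall fun x => mul_comm _ _)

theorem toLp_comp_sub_integral_mem_closure_span {Ω : Type*} [MeasurableSpace Ω] {P : Measure Ω}
    [IsProbabilityMeasure P] {X : Ω → ℝ} (hX : MeasurePreserving X P (gaussianReal 0 1))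
    (he : ∀ t, MemLp (fun ω => wickExp t (X ω) - 1) 2 P)
    {g : ℝ → ℝ} (hg : MemLp g 2 (gaussianReal 0 1))
    (hgc : MemLp (fun ω => g (X ω) - ∫ x, g x ∂(gaussianReal 0 1)) 2 P) :
    hgc.toLp ∈ (Submodule.span ℝ (Set.range fun t => (he t).toLp)).topologicalClosure := by
  have h1 : MemLp (fun _ : ℝ => (1 : ℝ)) 2 (gaussianReal 0 1) := memLp_const 1
  have h1P : MemLp (fun _ : Ω => (1 : ℝ)) 2 P := memLp_const 1
  -- T g = g ∘ X - E g is continuous and sends `wickExp t` to the centred exponential, so it carries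
  -- the dense span into the required closure.
  let T : Lp ℝ 2 (gaussianReal 0 1) →L[ℝ] Lp ℝ 2 P :=
    (Lp.compMeasurePreservingₗᵢ ℝ X hX).toContinuousLinearMap -
      (innerSL ℝ h1.toLp).smulRight h1P.toLp
  have hT : ∀ {f : ℝ → ℝ} (hf : MemLp f 2 (gaussianReal 0 1))
      (hfc : MemLp (fun ω => f (X ω) - ∫ x, f x ∂(gaussianReal 0 1)) 2 P),
      T hf.toLp = hfc.toLp := by
    intro f hf hfc
    have e1 : T hf.toLp = (hf.comp_measurePreserving hX).toLp -
        (∫ x, f x ∂(gaussianReal 0 1)) • h1P.toLp := by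
      simp only [T, _root_.sub_apply, ContinuousLinearMap.smulRight_apply,
        innerSL_apply_apply, inner_toLp_toLp, one_mul]
      rfl
    rw [e1, ← MemLp.toLp_const_smul, ← MemLp.toLp_sub]
    refine MemLp.toLp_congr _ _ (Filter.Eventually.of_forall fun ω => ?_)
    simp
  have hmem : hg.toLp ∈ (Submodule.span ℝ
      (Set.range fun t => (memLp_wickExp t).toLp)).topologicalClosure := by
    rw [topologicalClosure_span_wickExp]; trivial
  rw [← hT hg hgc]
  have hmap := Submodule.topologicalClosure_map T
    (Submodule.span ℝ (Set.range fun t => (memLp_wickExp t).toLp))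
    (Submodule.mem_map_of_mem hmem)
  rw [Submodule.map_span, ← Set.range_comp] at hmap
  have hrange : (Set.range fun t => (he t).toLp) =
      Set.range ((T : Lp ℝ 2 (gaussianReal 0 1) →ₗ[ℝ] Lp ℝ 2 P) ∘
        fun t => (memLp_wickExp t).toLp) := by
    congr 1
    ext1 t
    have hc : MemLp (fun ω => wickExp t (X ω) - ∫ x, wickExp t x ∂(gaussianReal 0 1)) 2 P := by
      rw [integral_wickExp]; exact he t
    refine Eq.trans ?_ (hT (memLp_wickExp t) hc).symm
    exact MemLp.toLp_congr _ _ (Filter.Eventually.of_forall fun ω => by simp [integral_wickExp])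
  rw [hrange]
  exact hmap

/-! ### Lower bound for functions of Gaussian variables -/

theorem integral_sum_sq_ge_of_gaussian {Ω n : Type*} [MeasurableSpace Ω] [Fintype n]
    [DecidableEq n] {P : Measure Ω} [IsProbabilityMeasure P] {R : Matrix n n ℝ} {c : ℝ}
    (hR : R.PosSemidef) (hdiag : ∀ i, R i i = 1) (hc : (R - c • (1 : Matrix n n ℝ)).PosSemidef)
    {X : n → Ω → ℝ} (hX : ∀ i, MeasurePreserving (X i) P (gaussianReal 0 1))
    (hjoint : ∀ i j s t, ∫ ω, Real.exp (s * X i ω + t * X j ω) ∂P =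
      Real.exp (s ^ 2 / 2 + t ^ 2 / 2 + R i j * (s * t)))
    {g : n → ℝ → ℝ} (hg : ∀ i, MemLp (g i) 2 (gaussianReal 0 1)) :
    c * ∑ i, ∫ ω, (g i (X i ω) - ∫ x, g i x ∂(gaussianReal 0 1)) ^ 2 ∂P ≤
      ∫ ω, (∑ i, (g i (X i ω) - ∫ x, g i x ∂(gaussianReal 0 1))) ^ 2 ∂P := by
  have hw : ∀ i t, MemLp (fun ω => wickExp t (X i ω)) 2 P := fun i t =>
    (memLp_wickExp t).comp_measurePreserving (hX i)
  have he : ∀ i t, MemLp (fun ω => wickExp t (X i ω) - 1) 2 P := fun i t =>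
    (hw i t).sub (memLp_const 1)
  have hu : ∀ i, MemLp (fun ω => g i (X i ω) - ∫ x, g i x ∂(gaussianReal 0 1)) 2 P := fun i =>
    ((hg i).comp_measurePreserving (hX i)).sub (memLp_const _)
  have hmean : ∀ i t, ∫ ω, wickExp t (X i ω) ∂P = 1 := by
    intro i t
    rw [← integral_wickExp t, ← (hX i).map_eq, integral_map (hX i).measurable.aemeasurable
      (measurable_wickExp t).aestronglyMeasurable]
  have hinner : ∀ i j s t, ⟪(he i s).toLp, (he j t).toLp⟫_ℝ = Real.exp (R i j * (s * t)) - 1 := by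
    intro i j s t
    have hprod : ∫ ω, wickExp s (X i ω) * wickExp t (X j ω) ∂P = Real.exp (R i j * (s * t)) := by
      have : ∀ ω, wickExp s (X i ω) * wickExp t (X j ω) =
          Real.exp (-(s ^ 2 / 2 + t ^ 2 / 2)) * Real.exp (s * X i ω + t * X j ω) := by
        intro ω
        rw [wickExp, wickExp, ← Real.exp_add, ← Real.exp_add]
        ring_nf
      simp only [this]
      rw [integral_const_mul, hjoint, ← Real.exp_add]
      ring_nf
    have hi := (hw i s).integrable (by norm_num)
    have hj := (hw j t).integrable (by norm_num)
    have hij : Integrable (fun ω => wickExp s (X i ω) * wickExp t (X j ω)) P :=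
      (hw i s).integrable_mul (hw j t)
    rw [inner_toLp_toLp]
    calc ∫ ω, (wickExp s (X i ω) - 1) * (wickExp t (X j ω) - 1) ∂P
        = ∫ ω, (wickExp s (X i ω) * wickExp t (X j ω) - wickExp s (X i ω))
            - (wickExp t (X j ω) - 1) ∂P := by congr 1; ext ω; ring
      _ = _ := by
        have hi' : Integrable (fun ω => wickExp s (X i ω) * wickExp t (X j ω) -
          wickExp s (X i ω)) P := hij.sub hi
        have hj' : Integrable (fun ω => wickExp t (X j ω) - 1) P := hj.sub (integrable_const 1)
        rw [integral_sub hi' hj', integral_sub hij hi,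
          integral_sub hj (integrable_const 1), hprod, hmean, hmean]
        simp
  have hmem : ∀ i, (hu i).toLp ∈
      (Submodule.span ℝ (Set.range fun t => (he i t).toLp)).topologicalClosure := fun i =>
    toLp_comp_sub_integral_mem_closure_span (hX i) (he i) (hg i) (hu i)
  have key := norm_sum_sq_ge_of_mem_closure_span hR hdiag hc (fun i t => (he i t).toLp) hinner
    (fun i => (hu i).toLp) hmem
  have hsum : ∑ i, (hu i).toLp = (memLp_finsetSum Finset.univ fun i _ => hu i).toLp := by
    refine Lp.ext ?_
    have hall : ∀ᵐ ω ∂P, ∀ i, ((hu i).toLp : Ω → ℝ) ω = g i (X i ω) - ∫ x, g i x ∂(gaussianReal 0 1) :=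
      ae_all_iff.2 fun i => (hu i).coeFn_toLp
    filter_upwards [Lp.coeFn_finsetSum Finset.univ fun i => (hu i).toLp,
      (memLp_finsetSum Finset.univ fun i _ => hu i).coeFn_toLp, hall] with ω h1 h2 h3
    rw [h1, h2, Finset.sum_apply]
    exact Finset.sum_congr rfl fun i _ => h3 i
  rw [hsum] at key
  simp only [← real_inner_self_eq_norm_sq, inner_toLp_toLp] at key
  simpa only [sq] using key

/-! ### Standardized features and their pair laws -/

section Standardized

variable {d : ℕ} {P : Measure (Fin d → ℝ)}

theorem measurable_standardized (i : Fin d) : Measurable (standardized P i) := by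
  unfold standardized
  exact ((measurable_pi_apply i).sub_const _).div_const _

theorem memLp_eval_of_isGaussian_pair
    (hgauss : ∀ i j : Fin d, IsGaussian (P.map (fun x => (x i, x j)))) (i : Fin d) :
    MemLp (fun x : Fin d → ℝ => x i) 2 P := by
  have := hgauss i i
  have h := IsGaussian.memLp_dual (P.map fun x : Fin d → ℝ => (x i, x i))
    (ContinuousLinearMap.fst ℝ ℝ ℝ) 2 (by norm_num)
  rw [memLp_map_measure_iff (by fun_prop) (by fun_prop)] at h
  exact h

theorem memLp_standardized [IsProbabilityMeasure P] (h2 : ∀ i, MemLp (fun x : Fin d → ℝ => x i) 2 P) (i : Fin d) :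
    MemLp (standardized P i) 2 P := by
  have := ((h2 i).sub (memLp_const (∫ y, y i ∂P))).const_mul
    (√(variance (fun y => y i) P))⁻¹
  refine this.ae_eq (Filter.Eventually.of_forall fun x => ?_)
  simp [standardized, div_eq_inv_mul]

theorem integral_standardized [IsProbabilityMeasure P] (h2 : ∀ i, MemLp (fun x : Fin d → ℝ => x i) 2 P) (i : Fin d) :
    ∫ x, standardized P i x ∂P = 0 := by
  simp only [standardized]
  rw [integral_div, integral_sub ((h2 i).integrable (by norm_num)) (integrable_const _)]
  simp

theorem correlationMatrix_apply_self (hvar : ∀ i : Fin d, 0 < variance (fun x : Fin d → ℝ => x i) P)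
    (i : Fin d) : correlationMatrix P i i = 1 := by
  simp only [correlationMatrix, Matrix.of_apply, standardized]
  have : ∀ x : Fin d → ℝ, (x i - ∫ y, y i ∂P) / √(variance (fun y => y i) P) *
      ((x i - ∫ y, y i ∂P) / √(variance (fun y => y i) P)) =
      (x i - ∫ y, y i ∂P) ^ 2 / variance (fun y : Fin d → ℝ => y i) P := by
    intro x
    rw [div_mul_div_comm, Real.mul_self_sqrt (hvar i).le, sq]
  simp only [this]
  rw [integral_div, ← variance_eq_integral (measurable_pi_apply i).aemeasurable]
  exact div_self (hvar i).ne'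

theorem posSemidef_correlationMatrix [IsProbabilityMeasure P] (h2 : ∀ i, MemLp (fun x : Fin d → ℝ => x i) 2 P) :
    (correlationMatrix P).PosSemidef := by
  refine Matrix.PosSemidef.of_dotProduct_mulVec_nonneg (correlationMatrix_isHermitian P) fun b => ?_
  have hmul : ∀ i j, Integrable (fun x => standardized P i x * standardized P j x) P := fun i j =>
    (memLp_standardized h2 i).integrable_mul (memLp_standardized h2 j)
  have hmul' : ∀ i j, Integrable
      (fun x => b i * standardized P i x * (b j * standardized P j x)) P := fun i j =>
    ((hmul i j).const_mul (b i * b j)).congr (Filter.Eventually.of_forall fun x => by simp only; ring)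
  have : star b ⬝ᵥ (correlationMatrix P *ᵥ b) = ∫ x, (∑ i, b i * standardized P i x) ^ 2 ∂P := by
    simp only [sq, Finset.sum_mul_sum]
    rw [integral_finsetSum _ fun i _ => integrable_finsetSum _ fun j _ => hmul' i j]
    simp only [dotProduct, Matrix.mulVec, star_trivial, Finset.mul_sum]
    refine Finset.sum_congr rfl fun i _ => ?_
    rw [integral_finsetSum _ fun j _ => hmul' i j]
    refine Finset.sum_congr rfl fun j _ => ?_
    simp only [correlationMatrix, Matrix.of_apply]
    rw [mul_comm _ (b j), ← mul_assoc, ← integral_const_mul]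
    congr 1; ext x; ring
  rw [this]
  exact integral_nonneg fun x => sq_nonneg _

/-- A combination of the pair is an affine image of a Gaussian vector, hence Gaussian and determined
by its mean and variance. Variance zero is allowed, which covers degenerate pairs and i = j. -/
theorem map_standardized_combination [IsProbabilityMeasure P]
    (hgauss : ∀ i j : Fin d, IsGaussian (P.map (fun x => (x i, x j))))
    (hvar : ∀ i : Fin d, 0 < variance (fun x : Fin d → ℝ => x i) P) (i j : Fin d) (s t : ℝ) :
    P.map (fun x => s * standardized P i x + t * standardized P j x) =
      gaussianReal 0 (s ^ 2 + t ^ 2 + 2 * correlationMatrix P i j * (s * t)).toNNReal := by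
  have h2 := memLp_eval_of_isGaussian_pair hgauss
  set Y : (Fin d → ℝ) → ℝ := fun x => s * standardized P i x + t * standardized P j x with hY
  have hYm : Measurable Y :=
    ((measurable_standardized i).const_mul s).add ((measurable_standardized j).const_mul t)
  have hYg : IsGaussian (P.map Y) := by
    have := hgauss i j
    set a := s / √(variance (fun y : Fin d → ℝ => y i) P) with ha
    set b := t / √(variance (fun y : Fin d → ℝ => y j) P) with hb
    let L : ℝ × ℝ →L[ℝ] ℝ :=
      a • ContinuousLinearMap.fst ℝ ℝ ℝ + b • ContinuousLinearMap.snd ℝ ℝ ℝ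
    have h : P.map Y = (((P.map fun x => (x i, x j)).map L).map
        fun r => r - (a * ∫ y, y i ∂P + b * ∫ y, y j ∂P)) := by
      rw [Measure.map_map (by fun_prop) (by fun_prop), Measure.map_map (by fun_prop) (by fun_prop)]
      congr 1
      ext x
      simp [hY, L, standardized, ha, hb]
      ring
    rw [h]
    infer_instance
  have hi1 := (memLp_standardized h2 i).integrable (by norm_num)
  have hj1 := (memLp_standardized h2 j).integrable (by norm_num)
  have hmean : ∫ x, Y x ∂P = 0 := by
    simp only [hY]
    rw [integral_add (hi1.const_mul s) (hj1.const_mul t), integral_const_mul, integral_const_mul,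
      integral_standardized h2, integral_standardized h2]
    simp
  have hVar : variance Y P = s ^ 2 + t ^ 2 + 2 * correlationMatrix P i j * (s * t) := by
    have hmul : ∀ i j, Integrable (fun x => standardized P i x * standardized P j x) P := fun i j =>
      (memLp_standardized h2 i).integrable_mul (memLp_standardized h2 j)
    rw [variance_of_integral_eq_zero hYm.aemeasurable hmean]
    have h : ∀ x, Y x ^ 2 = s ^ 2 * (standardized P i x * standardized P i x) +
        t ^ 2 * (standardized P j x * standardized P j x) +
        2 * (s * t) * (standardized P i x * standardized P j x) := fun x => by
      simp only [hY]; ring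
    simp only [h]
    have hsq : Integrable (fun x => s ^ 2 * (standardized P i x * standardized P i x) +
        t ^ 2 * (standardized P j x * standardized P j x)) P :=
      ((hmul i i).const_mul _).add ((hmul j j).const_mul _)
    rw [integral_add hsq ((hmul i j).const_mul _), integral_add ((hmul i i).const_mul _) ((hmul j j).const_mul _),
      integral_const_mul, integral_const_mul, integral_const_mul]
    have hi := correlationMatrix_apply_self hvar i
    have hj := correlationMatrix_apply_self hvar j
    simp only [correlationMatrix, Matrix.of_apply] at hi hj ⊢
    rw [hi, hj]
    ring
  rw [IsGaussian.eq_gaussianReal (P.map Y) hYg, variance_id_map hYm.aemeasurable, hVar]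
  congr 1
  rw [integral_map hYm.aemeasurable (by fun_prop)]
  exact hmean

theorem measurePreserving_standardized [IsProbabilityMeasure P]
    (hgauss : ∀ i j : Fin d, IsGaussian (P.map (fun x => (x i, x j))))
    (hvar : ∀ i : Fin d, 0 < variance (fun x : Fin d → ℝ => x i) P) (i : Fin d) :
    MeasurePreserving (standardized P i) P (gaussianReal 0 1) := by
  refine ⟨measurable_standardized i, ?_⟩
  simpa using map_standardized_combination hgauss hvar i i 1 0

theorem integral_exp_standardized_combination [IsProbabilityMeasure P]
    (hgauss : ∀ i j : Fin d, IsGaussian (P.map (fun x => (x i, x j))))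
    (hvar : ∀ i : Fin d, 0 < variance (fun x : Fin d → ℝ => x i) P) (i j : Fin d) (s t : ℝ) :
    ∫ x, Real.exp (s * standardized P i x + t * standardized P j x) ∂P =
      Real.exp (s ^ 2 / 2 + t ^ 2 / 2 + correlationMatrix P i j * (s * t)) := by
  have h := mgf_gaussianReal (map_standardized_combination hgauss hvar i j s t) 1
  -- Nonnegativity is needed to undo `Real.toNNReal`; it is the quadratic form of the i, j submatrix
  -- at (s, t).
  have hnn : 0 ≤ s ^ 2 + t ^ 2 + 2 * correlationMatrix P i j * (s * t) := by
    have hps := posSemidef_correlationMatrix (memLp_eval_of_isGaussian_pair hgauss)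
    have hi := correlationMatrix_apply_self hvar i
    have hj := correlationMatrix_apply_self hvar j
    have hji : correlationMatrix P j i = correlationMatrix P i j := by
      simp [correlationMatrix, mul_comm]
    have hq := (hps.submatrix ![i, j]).dotProduct_mulVec_nonneg ![s, t]
    simp [Matrix.mulVec, dotProduct, Fin.sum_univ_two, hi, hj, hji] at hq
    linarith
  rw [Real.coe_toNNReal _ hnn, mgf] at h
  simp only [one_mul] at h
  rw [h]
  ring_nf

end Standardized

/-! ### Second moments -/

theorem integral_const_add_sq {Ω : Type*} [MeasurableSpace Ω] {μ : Measure Ω}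
    [IsProbabilityMeasure μ] {v : Ω → ℝ} (hv : MemLp v 2 μ) (h0 : ∫ x, v x ∂μ = 0) (k : ℝ) :
    ∫ x, (k + v x) ^ 2 ∂μ = k ^ 2 + ∫ x, v x ^ 2 ∂μ := by
  have hi : Integrable v μ := hv.integrable (by norm_num)
  have h : ∀ x, (k + v x) ^ 2 = k ^ 2 + 2 * k * v x + v x ^ 2 := fun x => by ring
  simp only [h]
  have hlin : Integrable (fun x => k ^ 2 + 2 * k * v x) μ :=
    (integrable_const _).add (hi.const_mul _)
  rw [integral_add hlin hv.integrable_sq,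
    integral_add (integrable_const _) (hi.const_mul _), integral_const_mul, h0]
  simp

theorem integral_sum_sq_le {Ω n : Type*} [MeasurableSpace Ω] [Fintype n] {μ : Measure Ω}
    {v : n → Ω → ℝ} (hv : ∀ i, MemLp (v i) 2 μ) :
    ∫ x, (∑ i, v i x) ^ 2 ∂μ ≤ Fintype.card n * ∑ i, ∫ x, v i x ^ 2 ∂μ := by
  have hmul : ∀ i ∈ Finset.univ, Integrable (fun x => v i x ^ 2) μ := fun i _ =>
    (hv i).integrable_sq
  rw [← integral_finsetSum _ hmul, ← integral_const_mul]
  refine integral_mono (memLp_finsetSum Finset.univ fun i _ => hv i).integrable_sq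
    ((integrable_finsetSum _ hmul).const_mul _) fun x => ?_
  exact sq_sum_le_card_mul_sum_sq

theorem secondMoment_eq_ofReal {Ω : Type*} [MeasurableSpace Ω] {μ : Measure Ω} {h : Ω → ℝ}
    (hh : MemLp h 2 μ) : secondMoment μ h = ENNReal.ofReal (∫ x, h x ^ 2 ∂μ) :=
  (ofReal_integral_eq_lintegral_ofReal hh.integrable_sq
    (Filter.Eventually.of_forall fun _ => sq_nonneg _)).symm

theorem memLp_two_of_secondMoment_lt_top {Ω : Type*} [MeasurableSpace Ω] {μ : Measure Ω}
    {h : Ω → ℝ} (hm : AEStronglyMeasurable h μ) (hh : secondMoment μ h < ⊤) : MemLp h 2 μ := by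
  rw [memLp_two_iff_integrable_sq hm]
  refine ⟨hm.pow 2, ?_⟩
  rwa [hasFiniteIntegral_iff_ofReal (Filter.Eventually.of_forall fun _ => sq_nonneg _)]

/-! ### Additive functions under P and Q -/

section Additive

variable {d : ℕ} {P : Measure (Fin d → ℝ)}

theorem memLp_of_secondMoment_eval {f : ℝ → ℝ} {i : Fin d}
    (hm : AEMeasurable f (P.map fun x => x i)) (hf : secondMoment P (fun x => f (x i)) < ⊤) :
    MemLp f 2 (P.map fun x => x i) := by
  rw [memLp_map_measure_iff hm.aestronglyMeasurable (measurable_pi_apply i).aemeasurable]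
  exact memLp_two_of_secondMoment_lt_top
    (hm.comp_measurable (measurable_pi_apply i)).aestronglyMeasurable hf

theorem integral_sum_sq_ge_of_isGaussian_pair [IsProbabilityMeasure P]
    (hgauss : ∀ i j : Fin d, IsGaussian (P.map (fun x => (x i, x j))))
    (hvar : ∀ i : Fin d, 0 < variance (fun x : Fin d → ℝ => x i) P) {h : Fin d → ℝ → ℝ}
    (hh : ∀ i, MemLp (h i) 2 (P.map fun x => x i)) :
    lambdaMin (correlationMatrix_isHermitian P) *
        ∑ i, ∫ x, (h i (x i) - ∫ y, h i y ∂(P.map fun x => x i)) ^ 2 ∂P ≤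
      ∫ x, (∑ i, (h i (x i) - ∫ y, h i y ∂(P.map fun x => x i))) ^ 2 ∂P := by
  -- The inverse of standardization, so that h i ∘ A i is a function of the standard Gaussian
  -- feature.
  set A : Fin d → ℝ → ℝ := fun i y =>
    √(variance (fun y : Fin d → ℝ => y i) P) * y + ∫ y, y i ∂P with hA
  have hAm : ∀ i, Measurable (A i) := fun i => by simp only [hA]; fun_prop
  have hAX : ∀ i x, A i (standardized P i x) = x i := by
    intro i x
    have := (Real.sqrt_pos.2 (hvar i)).ne'
    simp only [hA, standardized]
    rw [mul_div_cancel₀ _ this]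
    ring
  have hX := measurePreserving_standardized hgauss hvar
  have hAp : ∀ i, MeasurePreserving (A i) (gaussianReal 0 1) (P.map fun x => x i) := by
    intro i
    refine ⟨hAm i, ?_⟩
    rw [← (hX i).map_eq, Measure.map_map (hAm i) (measurable_standardized i)]
    congr 1
    exact funext fun x => hAX i x
  have hg : ∀ i, MemLp (fun y => h i (A i y)) 2 (gaussianReal 0 1) := fun i =>
    (hh i).comp_measurePreserving (hAp i)
  have hmean : ∀ i, ∫ y, h i (A i y) ∂(gaussianReal 0 1) =
      ∫ y, h i y ∂(P.map fun x => x i) := by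
    intro i
    rw [← (hAp i).map_eq, integral_map (hAm i).aemeasurable]
    rw [(hAp i).map_eq]
    exact (hh i).1
  have key := integral_sum_sq_ge_of_gaussian
    (posSemidef_correlationMatrix (memLp_eval_of_isGaussian_pair hgauss))
    (correlationMatrix_apply_self hvar)
    (posSemidef_sub_lambdaMin (correlationMatrix_isHermitian P)) hX
    (integral_exp_standardized_combination hgauss hvar) hg
  simpa only [hAX, hmean] using key

theorem integral_additive_sq_eq [IsProbabilityMeasure P] {h : Fin d → ℝ → ℝ}
    (hh : ∀ i, MemLp (h i) 2 (P.map fun x => x i)) :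
    ∫ x, (∑ i, h i (x i)) ^ 2 ∂P = (∑ i, ∫ y, h i y ∂(P.map fun x => x i)) ^ 2 +
      ∫ x, (∑ i, (h i (x i) - ∫ y, h i y ∂(P.map fun x => x i))) ^ 2 ∂P := by
  have hu : ∀ i, MemLp (fun x : Fin d → ℝ => h i (x i)) 2 P := fun i =>
    (hh i).comp_of_map (measurable_pi_apply i).aemeasurable
  have hv : ∀ i, MemLp (fun x : Fin d → ℝ => h i (x i) - ∫ y, h i y ∂(P.map fun x => x i)) 2 P :=
    fun i => (hu i).sub (memLp_const _)
  rw [← integral_const_add_sq (memLp_finsetSum Finset.univ fun i _ => hv i)]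
  · simp
  · rw [integral_finsetSum _ fun i _ => (hv i).integrable (by norm_num)]
    refine Finset.sum_eq_zero fun i _ => ?_
    rw [integral_sub ((hu i).integrable (by norm_num)) (integrable_const _),
      integral_map (measurable_pi_apply i).aemeasurable (hh i).1]
    simp

/-- A diagonal entry 1 - λ of a positive semidefinite matrix is nonnegative. With 1 ≤ d this lets
the squared-mean term satisfy the final inequality too. -/
theorem lambdaMin_correlationMatrix_le_one [IsProbabilityMeasure P] (hd : 0 < d)
    (hvar : ∀ i : Fin d, 0 < variance (fun x : Fin d → ℝ => x i) P) :
    lambdaMin (correlationMatrix_isHermitian P) ≤ 1 := by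
  have h := (posSemidef_sub_lambdaMin (correlationMatrix_isHermitian P)).diag_nonneg
    (i := (⟨0, hd⟩ : Fin d))
  simp only [Matrix.sub_apply, correlationMatrix_apply_self hvar, Matrix.smul_apply,
    Matrix.one_apply_eq, smul_eq_mul, mul_one] at h
  linarith

theorem lambdaMin_mul_integral_additive_sq_le [IsProbabilityMeasure P] {Q : Measure (Fin d → ℝ)} [IsProbabilityMeasure Q]
    (hd : 0 < d) (hmarg : ∀ i : Fin d, P.map (fun x => x i) = Q.map (fun x => x i))
    (hgauss : ∀ i j : Fin d, IsGaussian (P.map (fun x => (x i, x j))))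
    (hvar : ∀ i : Fin d, 0 < variance (fun x : Fin d → ℝ => x i) P)
    (hpos : 0 ≤ lambdaMin (correlationMatrix_isHermitian P)) {h : Fin d → ℝ → ℝ}
    (hh : ∀ i, MemLp (h i) 2 (P.map fun x => x i)) :
    lambdaMin (correlationMatrix_isHermitian P) * ∫ x, (∑ i, h i (x i)) ^ 2 ∂Q ≤
      d * ∫ x, (∑ i, h i (x i)) ^ 2 ∂P := by
  have hhQ : ∀ i, MemLp (h i) 2 (Q.map fun x => x i) := fun i => hmarg i ▸ hh i
  have hlow := integral_sum_sq_ge_of_isGaussian_pair hgauss hvar hh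
  have hup := integral_sum_sq_le (μ := Q) (n := Fin d)
    (v := fun i x => h i (x i) - ∫ y, h i y ∂(P.map fun x => x i)) fun i =>
      ((hhQ i).comp_of_map (measurable_pi_apply i).aemeasurable).sub (memLp_const _)
  -- Each integrand depends on one coordinate only, so equality of marginals suffices.
  have hsame : ∀ i, ∫ x, (h i (x i) - ∫ y, h i y ∂(P.map fun x => x i)) ^ 2 ∂Q =
      ∫ x, (h i (x i) - ∫ y, h i y ∂(P.map fun x => x i)) ^ 2 ∂P := by
    intro i
    generalize ∫ y, h i y ∂(P.map fun x => x i) = m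
    have hm : AEStronglyMeasurable (fun y => (h i y - m) ^ 2) (P.map fun x => x i) :=
      ((hh i).1.sub aestronglyMeasurable_const).pow 2
    have hP := integral_map (μ := P) (measurable_pi_apply i).aemeasurable hm
    have hQ := integral_map (μ := Q) (measurable_pi_apply i).aemeasurable (hmarg i ▸ hm)
    rw [← hP, ← hQ, hmarg i]
  simp only [hsame, Fintype.card_fin] at hup
  have hP := integral_additive_sq_eq hh
  have hQ := integral_additive_sq_eq hhQ
  simp only [← hmarg] at hQ
  rw [hP, hQ]
  have hle1 := lambdaMin_correlationMatrix_le_one hd hvar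
  have hd1 : (1 : ℝ) ≤ d := by exact_mod_cast hd
  set l := lambdaMin (correlationMatrix_isHermitian P)
  set k := (∑ i, ∫ y, h i y ∂(P.map fun x => x i)) ^ 2
  have hk : 0 ≤ k := sq_nonneg _
  have h1 := mul_le_mul_of_nonneg_left hup hpos
  have h2 := mul_le_mul_of_nonneg_left hlow (by linarith : (0 : ℝ) ≤ d)
  have h3 : l * k ≤ d * k := mul_le_mul_of_nonneg_right (hle1.trans hd1) hk
  linarith

end Additive

/-! ### The bound on the error ratio -/

theorem mainTheorem2 (d : ℕ) (hd : 0 < d)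
    (P Q : Measure (Fin d → ℝ)) [IsProbabilityMeasure P] [IsProbabilityMeasure Q]
    (hmarg : ∀ i : Fin d, P.map (fun x => x i) = Q.map (fun x => x i))
    (hgauss : ∀ i j : Fin d, IsGaussian (P.map (fun x => (x i, x j))))
    (hvar : ∀ i : Fin d, 0 < variance (fun x : Fin d → ℝ => x i) P) :
    restrictedErrorRatio P Q (additiveClass P) ≤
      (d : ENNReal) / ENNReal.ofReal (lambdaMin (correlationMatrix_isHermitian P)) := by
  -- When λ ≤ 0 the denominator is 0, and d ≠ 0 makes the right-hand side ⊤.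
  rcases le_or_gt (lambdaMin (correlationMatrix_isHermitian P)) 0 with hl | hl
  · rw [ENNReal.ofReal_of_nonpos hl, ENNReal.div_zero (by exact_mod_cast hd.ne')]
    exact le_top
  refine iSup₂_le fun F hF => iSup₂_le fun G hG => ?_
  obtain ⟨f, hfm, hf2, rfl⟩ := hF
  obtain ⟨g, hgm, hg2, rfl⟩ := hG
  -- The difference of two additive functions is additive, so the supremum over pairs is controlled
  -- by the estimate for one function.
  have hh : ∀ i, MemLp (fun y => f i y - g i y) 2 (P.map fun x => x i) := fun i =>
    (memLp_of_secondMoment_eval (hfm i) (hf2 i)).sub (memLp_of_secondMoment_eval (hgm i) (hg2 i))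
  have hmem : ∀ (R : Measure (Fin d → ℝ)), (∀ i, P.map (fun x => x i) = R.map (fun x => x i)) →
      MemLp (fun x : Fin d → ℝ => ∑ i, (f i (x i) - g i (x i))) 2 R := fun R hR =>
    memLp_finsetSum Finset.univ fun i _ => by
      have hi := hh i
      rw [hR i] at hi
      exact hi.comp_of_map (measurable_pi_apply i).aemeasurable
  have key := lambdaMin_mul_integral_additive_sq_le hd hmarg hgauss hvar hl.le hh
  simp only [← Finset.sum_sub_distrib]
  rw [secondMoment_eq_ofReal (hmem P fun _ => rfl), secondMoment_eq_ofReal (hmem Q hmarg)]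
  refine ENNReal.div_le_of_le_mul ?_
  rw [← ENNReal.ofReal_natCast, ← ENNReal.ofReal_div_of_pos hl,
    ← ENNReal.ofReal_mul (by positivity)]
  refine ENNReal.ofReal_le_ofReal ?_
  rw [div_mul_eq_mul_div, le_div_iff₀ hl]
  linarith
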